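/- **Theorem (Local estimation).** Let a real matrix $H$ be partitioned into $m^2$ blocks $H_{ij}\in\mathbb{R}^{m_i\times n_j}$, $i,j\in\{1,\dots,m\}$, and write $H_i=[H_{i1}\ \cdots\ H_{im}]$. Let $G_h$ be the undirected graph on $\{1,\dots,m\}$ in which distinct $i,j$ are adjacent if and only if $H_{ij}\neq 0$ or $H_{ji}\neq 0$; let $N_i$ be the set of neighbours of $i$ in $G_h$. Write $M^\dagger$ for the Moore–Penrose pseudoinverse of $M$ and, for a subspace $V$, $\operatorname{Basis}(V)$ for any matrix whose columns form an orthonormal basis of $V$ (no columns if $V=0$). Given $z=[z_1^{\mathsf T}\ \cdots\ z_m^{\mathsf T}]^{\mathsf T}$ with $z_i\in\mathbb{R}^{m_i}$, consider the synchronous diffusive algorithm in which monitor $i$ starts with $$\hat x^{(i)}:=H_i^\dagger z_i,\qquad K_i:=\operatorname{Basis}(\operatorname{Ker} H_i),$$ and, in each iteration, if $K_i\neq 0$, goes through all $j\in N_i$ in some order, performing for each $j$ the updates $$\hat x^{(i)}:=\hat x^{(i)}+[K_i\ \ 0]\,[-K_i\ \ K_j]^\dagger(\hat x^{(i)}-\hat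 x^{(j)}),\qquad K_i:=\operatorname{Basis}(\operatorname{Im}K_i\cap\operatorname{Im}K_j),$$ where $\hat x^{(j)},K_j$ are the values held by monitor $j$ at the beginning of the iteration (if $K_i=0$, monitor $i$ keeps its values). Let $\hat x^{(i,h)}$ be the estimate of monitor $i$ after $h$ iterations, and let $\hat x_i^{(i,h)}\in\mathbb{R}^{n_i}$ be its $i$-th block. Let $\hat x_i$ be the $i$-th block of $\hat x=H^\dagger z$. For all real $a<b$ there exist $C>0$ and $q\in(0,1)$, depending only on $a$ and $b$, such that for every $m$, all block sizes, every block-partitioned $H$ of full row rank for which $[a,b]$ is the smallest interval containing the spectrum of $HH^{\mathsf T}$, every $z$, every execution of the algorithm, every monitor $i$ and every $h\in\mathbb{N}=\{0,1,2,\dots\}$, $$\|\hat x_i-\hat x_i^{(i,h)}\|_2\le C\,\|z\|_2\,q^{\frac h2+1}.$$ -/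

import Mathlib

namespace DiffusiveEstimation

open Matrix

/-! ### Moore–Penrose pseudoinverse of a real matrix -/

/-- The four Penrose equations: `P` is the Moore–Penrose pseudoinverse of `M`. -/
structure IsMoorePenrose {R N : Type*} [Fintype R] [Fintype N]
    (M : Matrix R N ℝ) (P : Matrix N R ℝ) : Prop where
  mul_mul : M * P * M = M
  mul_mul' : P * M * P = P
  symm_left : (M * P)ᵀ = M * P
  symm_right : (P * M)ᵀ = P * M

theorem exists_isMoorePenrose {R N : Type*} [Fintype R] [Fintype N]
    (M : Matrix R N ℝ) : ∃ P, IsMoorePenrose M P := by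
  classical
  obtain ⟨B, h1, h2, h3, h4⟩ : ∃ B : Matrix N N ℝ, (Mᵀ * M) * B * (Mᵀ * M) = Mᵀ * M ∧
      B * (Mᵀ * M) * B = B ∧ Bᵀ = B ∧ B * (Mᵀ * M) = (Mᵀ * M) * B := by
    have hA : (Mᵀ * M).IsHermitian := by
      simp [Matrix.IsHermitian, Matrix.conjTranspose_eq_transpose_of_trivial]
    obtain ⟨U, D, hU, hD⟩ : ∃ (U : Matrix N N ℝ) (D : N → ℝ), Uᵀ * U = 1 ∧
        Mᵀ * M = U * diagonal D * Uᵀ := by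
      refine ⟨hA.eigenvectorUnitary, hA.eigenvalues, ?_, ?_⟩
      · exact (Matrix.mem_unitaryGroup_iff'.1 hA.eigenvectorUnitary.2)
      · simpa [Unitary.conjStarAlgAut_apply, Matrix.star_eq_conjTranspose,
          Matrix.conjTranspose_eq_transpose_of_trivial, Function.comp_def]
          using hA.spectral_theorem
    have key : ∀ X Y : Matrix N N ℝ, (U * X * Uᵀ) * (U * Y * Uᵀ) = U * (X * Y) * Uᵀ := by
      intro X Y
      calc (U * X * Uᵀ) * (U * Y * Uᵀ) = U * X * (Uᵀ * U) * Y * Uᵀ := by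
            simp only [Matrix.mul_assoc]
        _ = _ := by rw [hU]; simp only [Matrix.mul_assoc, Matrix.one_mul]
    refine ⟨U * diagonal (fun i => (D i)⁻¹) * Uᵀ, ?_, ?_, ?_, ?_⟩
    · rw [hD, key, key, diagonal_mul_diagonal, diagonal_mul_diagonal]
      congr 3; ext i
      by_cases h : D i = 0 <;> simp [h]
    · rw [hD, key, key, diagonal_mul_diagonal, diagonal_mul_diagonal]
      congr 3; ext i
      by_cases h : D i = 0 <;> simp [h]
    · simp [Matrix.transpose_mul, Matrix.mul_assoc]
    · rw [hD, key, key, diagonal_mul_diagonal, diagonal_mul_diagonal]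
      congr 3; ext i; ring
  have hAs : (Mᵀ * M)ᵀ = Mᵀ * M := by simp
  refine ⟨B * Mᵀ, ?_, ?_, ?_, ?_⟩
  · have hz : (M * (B * Mᵀ) * M - M)ᴴ * (M * (B * Mᵀ) * M - M) = 0 := by
      rw [Matrix.conjTranspose_eq_transpose_of_trivial]
      have e : M * (B * Mᵀ) * M - M = M * (B * (Mᵀ * M) - 1) := by
        simp [Matrix.mul_sub, Matrix.mul_assoc]
      have e2 : (Mᵀ * M) * (B * (Mᵀ * M) - 1) = 0 := by
        rw [Matrix.mul_sub, ← Matrix.mul_assoc, h1, Matrix.mul_one, sub_self]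
      rw [e, Matrix.transpose_mul, Matrix.mul_assoc, ← Matrix.mul_assoc Mᵀ, e2, Matrix.mul_zero]
    exact sub_eq_zero.1 (Matrix.conjTranspose_mul_self_eq_zero.1 hz)
  · calc B * Mᵀ * M * (B * Mᵀ) = (B * (Mᵀ * M) * B) * Mᵀ := by simp only [Matrix.mul_assoc]
      _ = B * Mᵀ := by rw [h2]
  · simp [Matrix.transpose_mul, h3, Matrix.mul_assoc]
  · rw [Matrix.mul_assoc, Matrix.transpose_mul, hAs, h3, h4]

/-- The Moore–Penrose pseudoinverse `M†`. -/
noncomputable def pinv {R N : Type*} [Fintype R] [Fintype N]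
    (M : Matrix R N ℝ) : Matrix N R ℝ :=
  Classical.choose (exists_isMoorePenrose M)

theorem pinv_spec {R N : Type*} [Fintype R] [Fintype N] (M : Matrix R N ℝ) :
    IsMoorePenrose M (pinv M) :=
  Classical.choose_spec (exists_isMoorePenrose M)

/-! ### Block-partitioned matrices

`m` monitors; the rows of `H` are split into `m` groups of sizes `r i`, its columns into
`m` groups of sizes `n i`. A row is `⟨i, k⟩`, the `k`-th row of the `i`-th group. -/

/-- Indices of the rows (or of the columns) of a matrix split into groups of sizes `d i`. -/
abbrev BlockIdx {m : ℕ} (d : Fin m → ℕ) : Type := Σ i : Fin m, Fin (d i)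

/-- The block `H_{ij}`. -/
def block {m : ℕ} {r n : Fin m → ℕ} (H : Matrix (BlockIdx r) (BlockIdx n) ℝ) (i j : Fin m) :
    Matrix (Fin (r i)) (Fin (n j)) ℝ :=
  Matrix.of fun k l => H ⟨i, k⟩ ⟨j, l⟩

/-- The block row `H_i = [H_{i1} ⋯ H_{im}]`, known to monitor `i`. -/
def rowBlock {m : ℕ} {r n : Fin m → ℕ} (H : Matrix (BlockIdx r) (BlockIdx n) ℝ) (i : Fin m) :
    Matrix (Fin (r i)) (BlockIdx n) ℝ :=
  Matrix.of fun k c => H ⟨i, k⟩ c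

/-- The `i`-th block of a vector. -/
def vecBlock {m : ℕ} {d : Fin m → ℕ} (v : BlockIdx d → ℝ) (i : Fin m) : Fin (d i) → ℝ :=
  fun k => v ⟨i, k⟩

/-- The block-sparsity graph of `H`: `i` and `j` are adjacent iff `H_{ij} ≠ 0` or `H_{ji} ≠ 0`. -/
def sparsityGraph {m : ℕ} {r n : Fin m → ℕ} (H : Matrix (BlockIdx r) (BlockIdx n) ℝ) :
    SimpleGraph (Fin m) where
  Adj i j := i ≠ j ∧ (block H i j ≠ 0 ∨ block H j i ≠ 0)
  symm := ⟨fun _ _ h => ⟨h.1.symm, h.2.symm⟩⟩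
  loopless := ⟨fun _ h => h.1 rfl⟩

/-! ### The diffusive algorithm -/

/-- `K` is an orthonormal basis matrix of the subspace `V`: its columns are orthonormal and
span `V`. (The basis matrix of the zero subspace has no columns.) -/
def IsBasisMatrix {N : Type*} [Fintype N] {k : ℕ} (K : Matrix N (Fin k) ℝ)
    (V : Submodule ℝ (N → ℝ)) : Prop :=
  Kᵀ * K = 1 ∧ LinearMap.range K.mulVecLin = V

/-- What a monitor stores: an estimate `x̂` of the whole state, and a matrix `K`. -/
structure MonitorState (N : Type*) where
  est : N → ℝ
  k : ℕ
  K : Matrix N (Fin k) ℝ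

/-- Initialization from the local data: `x̂ := M† y`, `K := Basis(Ker M)`. -/
def IsInit {R N : Type*} [Fintype R] [Fintype N] (M : Matrix R N ℝ) (y : R → ℝ)
    (s : MonitorState N) : Prop :=
  s.est = pinv M *ᵥ y ∧ IsBasisMatrix s.K (LinearMap.ker M.mulVecLin)

/-- One pass of the `for` loop: a monitor in state `s` that has received `t = (x̂_j, K_j)` moves
to `s'`, where `x̂' = x̂ + [K 0] [-K K_j]† (x̂ - x̂_j)` and `K' = Basis(Im K ∩ Im K_j)`. -/
def IsUpdate {N : Type*} [Fintype N] (s t s' : MonitorState N) : Prop :=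
  s'.est = s.est + fromCols s.K (0 : Matrix N (Fin t.k) ℝ) *ᵥ
      (pinv (fromCols (-s.K) t.K) *ᵥ (s.est - t.est)) ∧
    IsBasisMatrix s'.K (LinearMap.range s.K.mulVecLin ⊓ LinearMap.range t.K.mulVecLin)

/-- The whole `for` loop, for the list of received states in the order in which they are
processed. -/
def IsForLoop {N : Type*} [Fintype N] :
    List (MonitorState N) → MonitorState N → MonitorState N → Prop
  | [], s, s' => s' = s
  | t :: ts, s, s' => ∃ u, IsUpdate s t u ∧ IsForLoop ts u s'

/-- One synchronous iteration with communication graph `G`. A monitor with `K = 0` has left its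
`while` loop and keeps its state; every other monitor processes, in some order, the states that
its neighbours had at the beginning of the iteration. -/
def IsIteration {N : Type*} [Fintype N] {m : ℕ} (G : SimpleGraph (Fin m))
    (σ σ' : Fin m → MonitorState N) : Prop :=
  ∀ i, ((σ i).K = 0 → σ' i = σ i) ∧
    ((σ i).K ≠ 0 → ∃ l : List (Fin m), l.Nodup ∧ (∀ j, j ∈ l ↔ G.Adj i j) ∧
      IsForLoop (l.map σ) (σ i) (σ' i))

/-- `σ h i` is the state of monitor `i` after `h` iterations, in an execution of the diffusive
algorithm on the system `z = H x`, where monitor `i` knows `H_i` and `z_i` and communicates along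
the block-sparsity graph of `H`. The choices of bases and the orders of the `for` loops
are arbitrary. -/
def IsExecution {m : ℕ} {r n : Fin m → ℕ} (H : Matrix (BlockIdx r) (BlockIdx n) ℝ)
    (z : BlockIdx r → ℝ) (σ : ℕ → Fin m → MonitorState (BlockIdx n)) : Prop :=
  (∀ i, IsInit (rowBlock H i) (vecBlock z i) (σ 0 i)) ∧
    ∀ h, IsIteration (sparsityGraph H) (σ h) (σ (h + 1))

end DiffusiveEstimation

/-!
The state of a monitor always consists of an orthonormal basis of a subspace `V` and of the
minimum-norm point of `x + V`, where `H x = z`. An update replaces `V` and the received `W` by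
`V ⊓ W`, so after `h` iterations `V` is the common kernel of the block rows at distance at most `h`
from `i`, and the estimate is `H_S† z_S`, with `S` the set of these monitors.

Both `H† z` and `H_S† z_S` are limits of Landweber iterations. Since `H_S H_Sᵀ` is a principal
submatrix of `H Hᵀ`, both converge at a rate governed by `[a, b]` alone. One Landweber step moves
information over graph distance two, so the two `k`-th iterates agree on block `i` as long as
`2 k ≤ h + 1`, and comparing them at `k = ⌊(h + 1) / 2⌋` gives the estimate.
-/

namespace DiffusiveEstimation

open Matrix

/-! ### Vectors and the pseudoinverse -/

section Pseudoinverse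

variable {R N : Type*} [Fintype R] [Fintype N]

theorem mulVec_dotProduct (M : Matrix R N ℝ) (v : N → ℝ) (w : R → ℝ) :
    (M *ᵥ v) ⬝ᵥ w = v ⬝ᵥ (Mᵀ *ᵥ w) := by
  rw [dotProduct_mulVec, vecMul_transpose]

theorem dotProduct_self_nonneg (v : N → ℝ) : 0 ≤ v ⬝ᵥ v := by
  simpa using dotProduct_star_self_nonneg v

theorem norm_toLp_sq (v : N → ℝ) : ‖WithLp.toLp 2 v‖ ^ 2 = v ⬝ᵥ v := by
  rw [EuclideanSpace.real_norm_sq_eq]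
  exact Finset.sum_congr rfl fun _ _ => sq _

theorem norm_toLp_comp_le {f : R → N} (hf : Function.Injective f) (v : N → ℝ) :
    ‖WithLp.toLp 2 (v ∘ f)‖ ≤ ‖WithLp.toLp 2 v‖ := by
  refine le_of_sq_le_sq ?_ (norm_nonneg _)
  rw [EuclideanSpace.real_norm_sq_eq, EuclideanSpace.real_norm_sq_eq]
  calc ∑ p, v (f p) ^ 2
      = ∑ c ∈ Finset.univ.map ⟨f, hf⟩, v c ^ 2 := by rw [Finset.sum_map]; rfl
    _ ≤ ∑ c, v c ^ 2 := Finset.sum_le_univ_sum_of_nonneg fun c => sq_nonneg (v c)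

theorem mulVec_pinv_mulVec_mulVec (M : Matrix R N ℝ) (x : N → ℝ) :
    M *ᵥ (pinv M *ᵥ (M *ᵥ x)) = M *ᵥ x := by
  rw [mulVec_mulVec, mulVec_mulVec, (pinv_spec M).mul_mul]

theorem pinv_mulVec_mem_range_transpose (M : Matrix R N ℝ) (y : R → ℝ) :
    pinv M *ᵥ y ∈ LinearMap.range Mᵀ.mulVecLin := by
  refine ⟨(pinv M)ᵀ *ᵥ (pinv M *ᵥ y), ?_⟩
  rw [mulVecLin_apply, mulVec_mulVec, ← transpose_mul, (pinv_spec M).symm_right, mulVec_mulVec,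
    (pinv_spec M).mul_mul']

theorem dotProduct_eq_zero_of_mem_range_transpose {M : Matrix R N ℝ} {v u : N → ℝ}
    (hv : v ∈ LinearMap.range Mᵀ.mulVecLin) (hu : M *ᵥ u = 0) : v ⬝ᵥ u = 0 := by
  obtain ⟨w, rfl⟩ := hv
  rw [mulVecLin_apply, mulVec_dotProduct, transpose_transpose, hu, dotProduct_zero]

theorem pinv_mulVec_dotProduct_eq_zero {M : Matrix R N ℝ} (y : R → ℝ) {u : N → ℝ}
    (hu : M *ᵥ u = 0) : (pinv M *ᵥ y) ⬝ᵥ u = 0 :=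
  dotProduct_eq_zero_of_mem_range_transpose (pinv_mulVec_mem_range_transpose M y) hu

theorem pinv_mulVec_mulVec_of_orthogonal_ker {M : Matrix R N ℝ} {v : N → ℝ}
    (hv : ∀ u, M *ᵥ u = 0 → v ⬝ᵥ u = 0) : pinv M *ᵥ (M *ᵥ v) = v := by
  have hker : M *ᵥ (v - pinv M *ᵥ (M *ᵥ v)) = 0 := by
    rw [mulVec_sub, mulVec_pinv_mulVec_mulVec, sub_self]
  have hzero : v - pinv M *ᵥ (M *ᵥ v) = 0 := by
    rw [← dotProduct_self_eq_zero, sub_dotProduct, hv _ hker,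
      pinv_mulVec_dotProduct_eq_zero _ hker, sub_self]
  exact (sub_eq_zero.1 hzero).symm

end Pseudoinverse

/-! ### What a monitor knows -/

/-- The state `s` represents the affine space `x + V`: its basis matrix is one of `V`, and its
estimate is the point of `x + V` of minimum norm, expressed as the point orthogonal to `V`. -/
structure Represents {N : Type*} [Fintype N] (s : MonitorState N) (x : N → ℝ)
    (V : Submodule ℝ (N → ℝ)) : Prop where
  isBasisMatrix : IsBasisMatrix s.K V
  sub_mem : x - s.est ∈ V
  dotProduct_eq_zero : ∀ u ∈ V, s.est ⬝ᵥ u = 0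

section Algorithm

variable {N : Type*} [Fintype N] {x : N → ℝ} {V W : Submodule ℝ (N → ℝ)}
  {s t s' : MonitorState N}

theorem IsBasisMatrix.mulVec_dotProduct_mulVec {k : ℕ} {K : Matrix N (Fin k) ℝ}
    (hK : IsBasisMatrix K V) (v w : Fin k → ℝ) : (K *ᵥ v) ⬝ᵥ (K *ᵥ w) = v ⬝ᵥ w := by
  rw [mulVec_dotProduct, mulVec_mulVec, hK.1, one_mulVec]

theorem IsBasisMatrix.mem_iff {k : ℕ} {K : Matrix N (Fin k) ℝ} (hK : IsBasisMatrix K V)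
    {v : N → ℝ} : v ∈ V ↔ ∃ α, K *ᵥ α = v := by
  rw [← hK.2]
  rfl

theorem IsInit.represents {R : Type*} [Fintype R] {M : Matrix R N ℝ} (h : IsInit M (M *ᵥ x) s) :
    Represents s x (LinearMap.ker M.mulVecLin) where
  isBasisMatrix := h.2
  sub_mem := by
    rw [LinearMap.mem_ker, mulVecLin_apply, h.1, mulVec_sub, mulVec_pinv_mulVec_mulVec, sub_self]
  dotProduct_eq_zero u hu := by
    rw [h.1]
    exact pinv_mulVec_dotProduct_eq_zero _ hu

theorem Represents.est_eq_pinv_mulVec {R : Type*} [Fintype R] {M : Matrix R N ℝ}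
    (h : Represents s x (LinearMap.ker M.mulVecLin)) : s.est = pinv M *ᵥ (M *ᵥ x) := by
  have hM : M *ᵥ x = M *ᵥ s.est := by
    have := h.sub_mem
    rwa [LinearMap.mem_ker, mulVecLin_apply, mulVec_sub, sub_eq_zero] at this
  rw [hM, pinv_mulVec_mulVec_of_orthogonal_ker h.dotProduct_eq_zero]

theorem IsUpdate.exists_est_eq (h : IsUpdate s t s')
    (hst : ∃ α β, s.est + s.K *ᵥ α = t.est + t.K *ᵥ β) :
    ∃ v w, s'.est = s.est + s.K *ᵥ v ∧ s'.est = t.est + t.K *ᵥ w ∧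
      ∀ γ δ, s.K *ᵥ γ = t.K *ᵥ δ → v ⬝ᵥ γ + w ⬝ᵥ δ = 0 := by
  obtain ⟨α, β, hαβ⟩ := hst
  set B := fromCols (-s.K) t.K with hB
  have hB_mulVec (γ δ) : B *ᵥ Sum.elim γ δ = t.K *ᵥ δ - s.K *ᵥ γ := by
    rw [hB, fromCols_mulVec_sumElim, neg_mulVec, neg_add_eq_sub]
  obtain ⟨v, w, hvw⟩ : ∃ v w, pinv B *ᵥ (s.est - t.est) = Sum.elim v w :=
    ⟨_, _, (Sum.elim_comp_inl_inr _).symm⟩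
  have hest : s'.est = s.est + s.K *ᵥ v := by
    rw [h.1, hvw, fromCols_mulVec_sumElim, zero_mulVec, add_zero]
  have hsolves : t.K *ᵥ w - s.K *ᵥ v = s.est - t.est := by
    have hrange : s.est - t.est = B *ᵥ Sum.elim α β := by
      rw [hB_mulVec, sub_eq_sub_iff_add_eq_add, hαβ, add_comm]
    rw [← hB_mulVec, ← hvw, hrange, mulVec_pinv_mulVec_mulVec]
  refine ⟨v, w, hest, ?_, fun γ δ hγδ => ?_⟩
  · rw [hest, add_comm t.est]
    exact (sub_eq_sub_iff_add_eq_add.1 hsolves).symm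
  · rw [← sumElim_dotProduct_sumElim, ← hvw]
    exact pinv_mulVec_dotProduct_eq_zero _ (by rw [hB_mulVec, hγδ, sub_self])

theorem Represents.update (hs : Represents s x V) (ht : Represents t x W)
    (h : IsUpdate s t s') : Represents s' x (V ⊓ W) := by
  obtain ⟨α, hα⟩ := hs.isBasisMatrix.mem_iff.1 hs.sub_mem
  obtain ⟨β, hβ⟩ := ht.isBasisMatrix.mem_iff.1 ht.sub_mem
  obtain ⟨v, w, hv, hw, hvw⟩ := h.exists_est_eq
    ⟨α, β, by rw [hα, hβ, add_sub_cancel, add_sub_cancel]⟩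
  refine ⟨by simpa only [hs.isBasisMatrix.2, ht.isBasisMatrix.2] using h.2, ⟨?_, ?_⟩, ?_⟩
  · rw [hv, ← sub_sub]
    exact V.sub_mem hs.sub_mem (hs.isBasisMatrix.mem_iff.2 ⟨v, rfl⟩)
  · rw [hw, ← sub_sub]
    exact W.sub_mem ht.sub_mem (ht.isBasisMatrix.mem_iff.2 ⟨w, rfl⟩)
  · rintro u ⟨huV, huW⟩
    obtain ⟨γ, rfl⟩ := hs.isBasisMatrix.mem_iff.1 huV
    obtain ⟨δ, hδ⟩ := ht.isBasisMatrix.mem_iff.1 huW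
    have hvγ : s'.est ⬝ᵥ (s.K *ᵥ γ) = v ⬝ᵥ γ := by
      rw [hv, add_dotProduct, hs.dotProduct_eq_zero _ huV, zero_add,
        hs.isBasisMatrix.mulVec_dotProduct_mulVec]
    have hwδ : s'.est ⬝ᵥ (s.K *ᵥ γ) = w ⬝ᵥ δ := by
      rw [hw, add_dotProduct, ht.dotProduct_eq_zero _ huW, zero_add, ← hδ,
        ht.isBasisMatrix.mulVec_dotProduct_mulVec]
    -- The two expressions for the same number sum to zero because `(γ, δ)` is in `Ker [-K_s K_t]`.
    linarith [hvw γ δ hδ.symm]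

theorem Represents.forLoop {ι : Type*} {σ : ι → MonitorState N}
    {W : ι → Submodule ℝ (N → ℝ)} (hs : Represents s x V) (hσ : ∀ j, Represents (σ j) x (W j))
    {l : List ι} (h : IsForLoop (l.map σ) s s') : Represents s' x (V ⊓ ⨅ j ∈ l, W j) := by
  induction l generalizing s V with
  | nil =>
    obtain rfl : s' = s := h
    simpa using hs
  | cons j l ih =>
    obtain ⟨t, ht, hl⟩ := h
    simpa [iInf_or, iInf_inf_eq, inf_assoc] using ih (hs.update (hσ j) ht) hl

theorem Represents.iteration {m : ℕ} {G : SimpleGraph (Fin m)} {σ σ' : Fin m → MonitorState N}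
    {V : Fin m → Submodule ℝ (N → ℝ)} (hσ : ∀ i, Represents (σ i) x (V i))
    (h : IsIteration G σ σ') (i : Fin m) :
    Represents (σ' i) x (V i ⊓ ⨅ j ∈ G.neighborSet i, V j) := by
  by_cases hK : (σ i).K = 0
  · have hbot : V i = ⊥ := by
      rw [← (hσ i).isBasisMatrix.2, hK, mulVecLin_zero, LinearMap.range_zero]
    rw [(h i).1 hK, hbot, bot_inf_eq, ← hbot]
    exact hσ i
  · obtain ⟨l, -, hl, hloop⟩ := (h i).2 hK
    simpa only [hl, SimpleGraph.mem_neighborSet] using (hσ i).forLoop hσ hloop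

end Algorithm

section Graph

variable {α : Type*} {G : SimpleGraph α} {c v w : α} {r : ℕ∞}

theorem mem_ball_add_one_of_adj (hv : v ∈ G.ball c r) (hvw : G.Adj v w) :
    w ∈ G.ball c (r + 1) := by
  rw [SimpleGraph.mem_ball] at hv ⊢
  have hwv : G.edist w v = 1 := SimpleGraph.edist_eq_one_iff_adj.2 hvw.symm
  calc G.edist w c ≤ G.edist w v + G.edist v c := SimpleGraph.edist_triangle
    _ = G.edist v c + 1 := by rw [hwv, add_comm]
    _ < r + 1 := (ENat.add_lt_add_iff_right ENat.one_ne_top).2 hv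

theorem ball_add_one (hr : 0 < r) :
    G.ball c (r + 1) = G.ball c r ∪ ⋃ w ∈ G.neighborSet c, G.ball w r := by
  ext v
  simp only [Set.mem_union, Set.mem_iUnion, SimpleGraph.mem_neighborSet, exists_prop]
  constructor
  · intro hv
    rw [SimpleGraph.mem_ball_comm, SimpleGraph.mem_ball] at hv
    obtain ⟨p, hp⟩ := SimpleGraph.exists_walk_of_edist_ne_top hv.ne_top
    cases p with
    | nil => exact Or.inl (by simpa using hr)
    | cons hcw p =>
      refine Or.inr ⟨_, hcw, SimpleGraph.mem_ball_comm.1 (SimpleGraph.edist_le p |>.trans_lt ?_)⟩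
      rw [← hp, SimpleGraph.Walk.length_cons, Nat.cast_succ] at hv
      exact (ENat.add_lt_add_iff_right ENat.one_ne_top).1 hv
  · rintro (hv | ⟨w, hcw, hv⟩)
    · exact SimpleGraph.ball_mono le_self_add hv
    · exact SimpleGraph.mem_ball_comm.1
        (mem_ball_add_one_of_adj (SimpleGraph.mem_ball_comm.1 hv) hcw.symm)

end Graph

/-- Mathlib's graph balls are open: the radius `h + 1` stands for distance at most `h`. -/
theorem IsExecution.represents {m : ℕ} {r n : Fin m → ℕ}
    {H : Matrix (BlockIdx r) (BlockIdx n) ℝ} {x : BlockIdx n → ℝ}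
    {σ : ℕ → Fin m → MonitorState (BlockIdx n)} (hσ : IsExecution H (H *ᵥ x) σ) (h : ℕ)
    (i : Fin m) :
    Represents (σ h i) x
      (⨅ j ∈ (sparsityGraph H).ball i (h + 1), LinearMap.ker (rowBlock H j).mulVecLin) := by
  induction h generalizing i with
  | zero =>
    have hi : IsInit (rowBlock H i) (rowBlock H i *ᵥ x) (σ 0 i) := hσ.1 i
    simpa using hi.represents
  | succ h ih =>
    have hball : (0 : ℕ∞) < h + 1 := by positivity
    rw [Nat.cast_succ, ball_add_one hball, iInf_union]
    simpa only [Set.mem_iUnion, iInf_exists, iInf_comm (ι := Fin m)] using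
      Represents.iteration ih (hσ.2 h) i

/-! ### The Landweber iteration -/

/-- The rows of `M` form a Riesz sequence with bounds `a` and `b`, that is, `a ≤ M Mᵀ ≤ b` as
quadratic forms; in this form the bounds pass to every subfamily of the rows. -/
structure HasRieszRows {R N : Type*} [Fintype R] [Fintype N] (M : Matrix R N ℝ) (a b : ℝ) :
    Prop where
  lower : ∀ u, a * (u ⬝ᵥ u) ≤ (Mᵀ *ᵥ u) ⬝ᵥ (Mᵀ *ᵥ u)
  upper : ∀ u, (Mᵀ *ᵥ u) ⬝ᵥ (Mᵀ *ᵥ u) ≤ b * (u ⬝ᵥ u)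

/-- The Landweber iterates with step `ω`, started at `0`, for the system `M v = w`. -/
def landweber {R N : Type*} [Fintype R] [Fintype N] (M : Matrix R N ℝ) (w : R → ℝ) (ω : ℝ) :
    ℕ → N → ℝ
  | 0 => 0
  | k + 1 => landweber M w ω k + ω • (Mᵀ *ᵥ (w - M *ᵥ landweber M w ω k))

section Landweber

variable {R N : Type*} [Fintype R] [Fintype N] {M : Matrix R N ℝ} {a b : ℝ}

theorem transpose_mulVec_dotProduct_self (M : Matrix R N ℝ) (u : R → ℝ) :
    (Mᵀ *ᵥ u) ⬝ᵥ (Mᵀ *ᵥ u) = u ⬝ᵥ ((M * Mᵀ) *ᵥ u) := by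
  rw [mulVec_dotProduct, transpose_transpose, mulVec_mulVec]

open scoped MatrixOrder in
theorem pos_of_mem_spectrum_mul_transpose [DecidableEq R] (hM : M.rank = Fintype.card R)
    {t : ℝ} (ht : t ∈ spectrum ℝ (M * Mᵀ)) : 0 < t := by
  have hrows : LinearIndependent ℝ M.row := by
    rw [linearIndependent_iff_card_eq_finrank_span, ← hM, M.rank_eq_finrank_span_row]
    rfl
  have hpos : (M * Mᴴ).PosDef :=
    PosDef.mul_conjTranspose_self M (vecMul_injective_iff.2 hrows)
  exact hpos.isStrictlyPositive.spectrum_pos ht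

open scoped MatrixOrder in
theorem HasRieszRows.of_spectrum_subset [DecidableEq R]
    (hM : spectrum ℝ (M * Mᵀ) ⊆ Set.Icc a b) : HasRieszRows M a b := by
  have hsa : IsSelfAdjoint (M * Mᵀ) := isHermitian_mul_conjTranspose_self M
  constructor <;> intro u <;> rw [transpose_mulVec_dotProduct_self]
  · have hle : algebraMap ℝ _ a ≤ M * Mᵀ := algebraMap_le_of_le_spectrum fun t ht => (hM ht).1
    simpa [Algebra.algebraMap_eq_smul_one, sub_mulVec, smul_mulVec] using
      (le_iff.1 hle).dotProduct_mulVec_nonneg u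
  · have hle : M * Mᵀ ≤ algebraMap ℝ _ b := le_algebraMap_of_spectrum_le fun t ht => (hM ht).2
    simpa [Algebra.algebraMap_eq_smul_one, sub_mulVec, smul_mulVec] using
      (le_iff.1 hle).dotProduct_mulVec_nonneg u

theorem HasRieszRows.submatrix {R' : Type*} [Fintype R'] (hM : HasRieszRows M a b) {f : R' → R}
    (hf : Function.Injective f) : HasRieszRows (M.submatrix f id) a b := by
  have hdot (u : R' → ℝ) :
      u ⬝ᵥ u = Function.extend f u 0 ⬝ᵥ Function.extend f u 0 :=
    Fintype.sum_of_injective f hf _ _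
      (fun p hp => by rw [Function.extend_apply' _ _ _ hp, Pi.zero_apply, mul_zero])
      (fun p => by rw [hf.extend_apply])
  have hmul (u : R' → ℝ) :
      (M.submatrix f id)ᵀ *ᵥ u = Mᵀ *ᵥ Function.extend f u 0 := by
    ext c
    exact Fintype.sum_of_injective f hf _ _
      (fun p hp => by rw [Function.extend_apply' _ _ _ hp, Pi.zero_apply, mul_zero])
      (fun p => by rw [hf.extend_apply]; rfl)
  constructor <;> intro u <;> rw [hdot, hmul]
  exacts [hM.lower _, hM.upper _]

theorem HasRieszRows.mulVec_pinv_mulVec (hM : HasRieszRows M a b) (ha : 0 < a) (w : R → ℝ) :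
    M *ᵥ (pinv M *ᵥ w) = w := by
  set d := M *ᵥ (pinv M *ᵥ w) - w
  have hker : Mᵀ *ᵥ d = 0 := by
    have hnormal : Mᵀ * (M * pinv M) = Mᵀ := by
      rw [← (pinv_spec M).symm_left, ← transpose_mul, (pinv_spec M).mul_mul]
    rw [mulVec_sub, mulVec_mulVec w M, mulVec_mulVec, hnormal, sub_self]
  have hle : a * (d ⬝ᵥ d) ≤ 0 := by simpa [hker] using hM.lower d
  have hd : d ⬝ᵥ d = 0 :=
    (nonpos_of_mul_nonpos_right hle ha).antisymm (dotProduct_self_nonneg d)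
  exact sub_eq_zero.1 (dotProduct_self_eq_zero.1 hd)

theorem HasRieszRows.lower_of_mem_range (hM : HasRieszRows M a b) (ha : 0 ≤ a) {v : N → ℝ}
    (hv : v ∈ LinearMap.range Mᵀ.mulVecLin) : a * (v ⬝ᵥ v) ≤ (M *ᵥ v) ⬝ᵥ (M *ᵥ v) := by
  obtain ⟨u, rfl⟩ := hv
  rw [mulVecLin_apply]
  set y := M *ᵥ (Mᵀ *ᵥ u) with hy
  have huy : u ⬝ᵥ y = (Mᵀ *ᵥ u) ⬝ᵥ (Mᵀ *ᵥ u) := by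
    rw [hy, mulVec_mulVec, transpose_mulVec_dotProduct_self]
  have hsq : 0 ≤ y ⬝ᵥ y - 2 * a * (u ⬝ᵥ y) + a * (a * (u ⬝ᵥ u)) := by
    convert dotProduct_self_nonneg (y - a • u) using 1
    simp only [sub_dotProduct, dotProduct_sub, smul_dotProduct, dotProduct_smul, smul_eq_mul,
      dotProduct_comm y u]
    ring
  rw [huy] at hsq
  linarith [mul_le_mul_of_nonneg_left (hM.lower u) ha]

theorem HasRieszRows.landweber_step_le (hM : HasRieszRows M a b) (ha : 0 ≤ a) (hb : 0 < b)
    {e : N → ℝ} (he : e ∈ LinearMap.range Mᵀ.mulVecLin) :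
    (e - b⁻¹ • (Mᵀ *ᵥ (M *ᵥ e))) ⬝ᵥ (e - b⁻¹ • (Mᵀ *ᵥ (M *ᵥ e))) ≤ (1 - a / b) * (e ⬝ᵥ e) := by
  set y := M *ᵥ e
  have hcross : e ⬝ᵥ (Mᵀ *ᵥ y) = y ⬝ᵥ y := (mulVec_dotProduct M e y).symm
  calc (e - b⁻¹ • (Mᵀ *ᵥ y)) ⬝ᵥ (e - b⁻¹ • (Mᵀ *ᵥ y))
      = e ⬝ᵥ e - 2 * b⁻¹ * (y ⬝ᵥ y) + b⁻¹ ^ 2 * ((Mᵀ *ᵥ y) ⬝ᵥ (Mᵀ *ᵥ y)) := by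
        simp only [sub_dotProduct, dotProduct_sub, smul_dotProduct, dotProduct_smul, smul_eq_mul,
          dotProduct_comm (Mᵀ *ᵥ y) e, hcross]
        ring
    _ ≤ e ⬝ᵥ e - 2 * b⁻¹ * (y ⬝ᵥ y) + b⁻¹ ^ 2 * (b * (y ⬝ᵥ y)) := by
        gcongr
        exact hM.upper y
    _ = e ⬝ᵥ e - b⁻¹ * (y ⬝ᵥ y) := by
        field_simp
        ring
    _ ≤ e ⬝ᵥ e - b⁻¹ * (a * (e ⬝ᵥ e)) := by
        gcongr
        exact hM.lower_of_mem_range ha he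
    _ = (1 - a / b) * (e ⬝ᵥ e) := by ring

theorem landweber_mem_range_transpose (M : Matrix R N ℝ) (w : R → ℝ) (ω : ℝ) (k : ℕ) :
    landweber M w ω k ∈ LinearMap.range Mᵀ.mulVecLin := by
  induction k with
  | zero => exact Submodule.zero_mem _
  | succ k ih => exact Submodule.add_mem _ ih (Submodule.smul_mem _ _ ⟨_, rfl⟩)

theorem HasRieszRows.sub_landweber_dotProduct_self_le (hM : HasRieszRows M a b) (ha : 0 ≤ a)
    (hab : a ≤ b) (hb : 0 < b) {v : N → ℝ} (hv : v ∈ LinearMap.range Mᵀ.mulVecLin) (k : ℕ) :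
    (v - landweber M (M *ᵥ v) b⁻¹ k) ⬝ᵥ (v - landweber M (M *ᵥ v) b⁻¹ k) ≤
      (1 - a / b) ^ k * (v ⬝ᵥ v) := by
  have hq : 0 ≤ 1 - a / b := sub_nonneg.2 ((div_le_one hb).2 hab)
  induction k with
  | zero => simp [landweber]
  | succ k ih =>
    set e := v - landweber M (M *ᵥ v) b⁻¹ k
    have hstep : v - landweber M (M *ᵥ v) b⁻¹ (k + 1) = e - b⁻¹ • (Mᵀ *ᵥ (M *ᵥ e)) := by
      rw [landweber, ← mulVec_sub, sub_add_eq_sub_sub]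
    have herange : e ∈ LinearMap.range Mᵀ.mulVecLin :=
      Submodule.sub_mem _ hv (landweber_mem_range_transpose M _ _ k)
    rw [hstep, pow_succ', mul_assoc]
    exact (hM.landweber_step_le ha hb herange).trans (mul_le_mul_of_nonneg_left ih hq)

theorem HasRieszRows.norm_pinv_mulVec_sub_landweber_le (hM : HasRieszRows M a b) (ha : 0 < a)
    (hab : a ≤ b) (w : R → ℝ) (k : ℕ) :
    ‖WithLp.toLp 2 (pinv M *ᵥ w - landweber M w b⁻¹ k)‖ ≤
      √(1 - a / b) ^ k * (‖WithLp.toLp 2 w‖ / √a) := by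
  have hb : 0 < b := ha.trans_le hab
  have hq : 0 ≤ 1 - a / b := sub_nonneg.2 ((div_le_one hb).2 hab)
  have hrange := pinv_mulVec_mem_range_transpose M w
  have herror := hM.sub_landweber_dotProduct_self_le ha.le hab hb hrange k
  have hpinv := hM.lower_of_mem_range ha.le hrange
  rw [hM.mulVec_pinv_mulVec ha] at herror hpinv
  refine le_of_sq_le_sq ?_ (by positivity)
  calc ‖WithLp.toLp 2 (pinv M *ᵥ w - landweber M w b⁻¹ k)‖ ^ 2
      ≤ (1 - a / b) ^ k * ((pinv M *ᵥ w) ⬝ᵥ (pinv M *ᵥ w)) := by rwa [norm_toLp_sq]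
    _ ≤ (1 - a / b) ^ k * ((w ⬝ᵥ w) / a) := by
        gcongr
        rwa [le_div_iff₀' ha]
    _ = (√(1 - a / b) ^ k * (‖WithLp.toLp 2 w‖ / √a)) ^ 2 := by
        rw [mul_pow, div_pow, norm_toLp_sq, Real.sq_sqrt ha.le, ← pow_mul, mul_comm k 2, pow_mul,
          Real.sq_sqrt hq]

theorem HasRieszRows.norm_pinv_mulVec_sub_submatrix_comp_le {R' ι : Type*} [Fintype R'] [Fintype ι]
    (hM : HasRieszRows M a b) (ha : 0 < a) (hab : a ≤ b) {f : R' → R} (hf : Function.Injective f)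
    {g : ι → N} (hg : Function.Injective g) (w : R → ℝ) {k : ℕ}
    (hk : landweber (M.submatrix f id) (w ∘ f) b⁻¹ k ∘ g = landweber M w b⁻¹ k ∘ g) :
    ‖WithLp.toLp 2 ((pinv M *ᵥ w) ∘ g - (pinv (M.submatrix f id) *ᵥ (w ∘ f)) ∘ g)‖ ≤
      2 * (√(1 - a / b) ^ k * (‖WithLp.toLp 2 w‖ / √a)) := by
  set L := landweber M w b⁻¹ k
  set L' := landweber (M.submatrix f id) (w ∘ f) b⁻¹ k
  set v := pinv M *ᵥ w
  set v' := pinv (M.submatrix f id) *ᵥ (w ∘ f)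
  have hv : ‖WithLp.toLp 2 ((v - L) ∘ g)‖ ≤ √(1 - a / b) ^ k * (‖WithLp.toLp 2 w‖ / √a) :=
    (norm_toLp_comp_le hg _).trans (hM.norm_pinv_mulVec_sub_landweber_le ha hab w k)
  have hv' : ‖WithLp.toLp 2 ((v' - L') ∘ g)‖ ≤ √(1 - a / b) ^ k * (‖WithLp.toLp 2 w‖ / √a) := by
    refine (norm_toLp_comp_le hg _).trans <|
      ((hM.submatrix hf).norm_pinv_mulVec_sub_landweber_le ha hab _ k).trans ?_
    gcongr
    exact norm_toLp_comp_le hf w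
  have hsplit : v ∘ g - v' ∘ g = (v - L) ∘ g - (v' - L') ∘ g := by
    rw [Pi.sub_comp, Pi.sub_comp, hk, sub_sub_sub_cancel_right]
  rw [hsplit, WithLp.toLp_sub, two_mul]
  exact (norm_sub_le _ _).trans (add_le_add hv hv')

/-- Here `t k` stands for the unknowns that the discarded equations have not reached after `k`
steps. -/
theorem landweber_submatrix_apply {R' : Type*} [Fintype R'] {f : R' → R}
    (hf : Function.Injective f) (w : R → ℝ) (ω : ℝ) {t : ℕ → Set N}
    (ht_succ : ∀ k, t (k + 1) ⊆ t k)
    (ht_range : ∀ k, ∀ c ∈ t (k + 1), ∀ p, M p c ≠ 0 → p ∈ Set.range f)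
    (ht_mem : ∀ k, ∀ c ∈ t (k + 1), ∀ p, M p c ≠ 0 → ∀ e, M p e ≠ 0 → e ∈ t k)
    {k : ℕ} {c : N} (hc : c ∈ t k) :
    landweber (M.submatrix f id) (w ∘ f) ω k c = landweber M w ω k c := by
  induction k generalizing c with
  | zero => rfl
  | succ k ih =>
    set L := landweber M w ω k
    set L' := landweber (M.submatrix f id) (w ∘ f) ω k
    have hresidual {p : R'} (hp : M (f p) c ≠ 0) :
        (M.submatrix f id *ᵥ L') p = (M *ᵥ L) (f p) := by
      refine Finset.sum_congr rfl fun e _ => ?_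
      by_cases he : M (f p) e = 0
      · simp [he]
      · rw [ih (ht_mem k c hc _ hp e he)]
        rfl
    have hcorrection : ((M.submatrix f id)ᵀ *ᵥ (w ∘ f - M.submatrix f id *ᵥ L')) c =
        (Mᵀ *ᵥ (w - M *ᵥ L)) c := by
      refine Fintype.sum_of_injective f hf _ _ (fun p hp => ?_) fun p => ?_
      · have hpc : M p c = 0 := not_imp_comm.1 (ht_range k c hc p) hp
        simp [hpc]
      · by_cases hpc : M (f p) c = 0
        · simp [hpc]
        · simp [hresidual hpc]
    change L' c + ω • _ = L c + ω • _
    rw [ih (ht_succ k hc), hcorrection]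

end Landweber

/-! ### Block rows within a ball -/

section Block

variable {m : ℕ} {r n : Fin m → ℕ} {H : Matrix (BlockIdx r) (BlockIdx n) ℝ}

/-- `H_S`: the block rows `H_j` with `j ∈ S`. -/
abbrev restrictRows (S : Set (Fin m)) (H : Matrix (BlockIdx r) (BlockIdx n) ℝ) :
    Matrix {p : BlockIdx r // p.1 ∈ S} (BlockIdx n) ℝ :=
  H.submatrix Subtype.val id

theorem ker_restrictRows (S : Set (Fin m)) (H : Matrix (BlockIdx r) (BlockIdx n) ℝ) :
    LinearMap.ker (restrictRows S H).mulVecLin =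
      ⨅ j ∈ S, LinearMap.ker (rowBlock H j).mulVecLin := by
  ext v
  simp only [Submodule.mem_iInf, LinearMap.mem_ker, mulVecLin_apply, funext_iff, Subtype.forall,
    Sigma.forall]
  exact forall_congr' fun j => forall_comm

theorem edist_sparsityGraph_le_one {p : BlockIdx r} {c : BlockIdx n} (hpc : H p c ≠ 0) :
    (sparsityGraph H).edist p.1 c.1 ≤ 1 := by
  rw [SimpleGraph.edist_le_one_iff_adj_or_eq, or_iff_not_imp_right]
  exact fun hne => ⟨hne, Or.inl fun hblock => hpc (congrFun₂ hblock p.2 c.2)⟩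

theorem landweber_restrictRows_apply (H : Matrix (BlockIdx r) (BlockIdx n) ℝ)
    (z : BlockIdx r → ℝ) (ω : ℝ) (i : Fin m) {h k : ℕ}
    [Fintype {p : BlockIdx r // p.1 ∈ (sparsityGraph H).ball i (h + 1)}] {c : BlockIdx n}
    (hc : (sparsityGraph H).edist c.1 i + 2 * k ≤ h + 1) :
    landweber (restrictRows ((sparsityGraph H).ball i (h + 1)) H) (z ∘ Subtype.val) ω k c =
      landweber H z ω k c := by
  have hstep {v w : Fin m} (hvw : (sparsityGraph H).edist v w ≤ 1) :
      (sparsityGraph H).edist v i ≤ (sparsityGraph H).edist w i + 1 :=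
    SimpleGraph.edist_triangle.trans (by rw [add_comm]; gcongr)
  have hrow {c : BlockIdx n} {p : BlockIdx r} (hpc : H p c ≠ 0) :
      (sparsityGraph H).edist p.1 i ≤ (sparsityGraph H).edist c.1 i + 1 :=
    hstep (edist_sparsityGraph_le_one hpc)
  have hcol {p : BlockIdx r} {e : BlockIdx n} (hpe : H p e ≠ 0) :
      (sparsityGraph H).edist e.1 i ≤ (sparsityGraph H).edist p.1 i + 1 :=
    hstep (SimpleGraph.edist_comm.trans_le (edist_sparsityGraph_le_one hpe))
  refine landweber_submatrix_apply Subtype.val_injective z ω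
    (t := fun k => {c | (sparsityGraph H).edist c.1 i + 2 * k ≤ h + 1}) (fun k c hc => ?_)
    (fun k c hc p hpc => ?_) (fun k c hc p hpc e hpe => ?_) (Set.mem_ofPred.2 hc)
  · refine le_trans ?_ (Set.mem_ofPred.1 hc)
    gcongr
    exact k.le_succ
  · rw [Subtype.range_coe_subtype, Set.mem_ofPred, SimpleGraph.mem_ball,
      ENat.lt_natCast_add_one_iff, ← ENat.add_le_add_iff_right ENat.one_ne_top]
    refine le_trans ?_ (Set.mem_ofPred.1 hc)
    calc (sparsityGraph H).edist p.1 i + 1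
        ≤ (sparsityGraph H).edist c.1 i + 1 + 1 := by
          gcongr
          exact hrow hpc
      _ ≤ (sparsityGraph H).edist c.1 i + 2 * (k + 1 : ℕ) := by
          rw [add_assoc, one_add_one_eq_two]
          gcongr
          exact le_mul_of_one_le_right' (by simp)
  · refine le_trans ?_ (Set.mem_ofPred.1 hc)
    calc (sparsityGraph H).edist e.1 i + 2 * k
        ≤ (sparsityGraph H).edist c.1 i + 1 + 1 + 2 * k := by
          gcongr
          exact (hcol hpe).trans (by gcongr; exact hrow hpc)
      _ = (sparsityGraph H).edist c.1 i + 2 * (k + 1 : ℕ) := by push_cast; ring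

theorem IsExecution.est_eq_pinv_mulVec {x : BlockIdx n → ℝ}
    {σ : ℕ → Fin m → MonitorState (BlockIdx n)} (hσ : IsExecution H (H *ᵥ x) σ) (i : Fin m) (h : ℕ)
    [Fintype {p : BlockIdx r // p.1 ∈ (sparsityGraph H).ball i (h + 1)}] :
    (σ h i).est = pinv (restrictRows ((sparsityGraph H).ball i (h + 1)) H) *ᵥ
      ((H *ᵥ x) ∘ Subtype.val) := by
  have hrepr := hσ.represents h i
  rw [← ker_restrictRows] at hrepr
  exact hrepr.est_eq_pinv_mulVec

theorem IsExecution.norm_vecBlock_pinv_sub_est_le {a b : ℝ} (hH : HasRieszRows H a b)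
    (ha : 0 < a) (hab : a ≤ b) {z : BlockIdx r → ℝ} {σ : ℕ → Fin m → MonitorState (BlockIdx n)}
    (hσ : IsExecution H z σ) (i : Fin m) {h k : ℕ} (hk : 2 * k ≤ h + 1) :
    ‖WithLp.toLp 2 (vecBlock (pinv H *ᵥ z) i - vecBlock (σ h i).est i)‖ ≤
      2 * (√(1 - a / b) ^ k * (‖WithLp.toLp 2 z‖ / √a)) := by
  classical
  have hz : H *ᵥ (pinv H *ᵥ z) = z := hH.mulVec_pinv_mulVec ha z
  have hest := IsExecution.est_eq_pinv_mulVec (hz.symm ▸ hσ) i h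
  rw [hz] at hest
  rw [hest]
  refine hH.norm_pinv_mulVec_sub_submatrix_comp_le ha hab Subtype.val_injective
    sigma_mk_injective z (k := k) (funext fun l => ?_)
  exact landweber_restrictRows_apply H z b⁻¹ i (by simpa using mod_cast hk)

end Block

end DiffusiveEstimation

open Matrix DiffusiveEstimation in
theorem mainTheorem4_general (a b : ℝ) (ha : 0 < a) (hab : a < b) :
    ∃ C : ℝ, 0 < C ∧ ∃ q : ℝ, q ∈ Set.Ioo (0 : ℝ) 1 ∧
      ∀ (m : ℕ) (r n : Fin m → ℕ) (H : Matrix (BlockIdx r) (BlockIdx n) ℝ),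
        spectrum ℝ (H * Hᵀ) ⊆ Set.Icc a b →
        ∀ (z : BlockIdx r → ℝ) (σ : ℕ → Fin m → MonitorState (BlockIdx n)), IsExecution H z σ →
          ∀ (i : Fin m) (h : ℕ),
            ‖WithLp.toLp 2 (vecBlock (pinv H *ᵥ z) i - vecBlock (σ h i).est i)‖ ≤
              C * ‖WithLp.toLp 2 z‖ * q ^ ((h : ℝ) / 2 + 1) := by
  have hb : 0 < b := ha.trans hab
  set q := √(1 - a / b)
  have hq0 : 0 < q := Real.sqrt_pos.2 (sub_pos.2 ((div_lt_one hb).2 hab))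
  have hq1 : q < 1 := (Real.sqrt_lt' one_pos).2 (by simpa using div_pos ha hb)
  refine ⟨2 / (√a * q), by positivity, q, ⟨hq0, hq1⟩, fun m r n H hH z σ hσ i h => ?_⟩
  have hfloor : (h : ℝ) / 2 ≤ ((h + 1) / 2 : ℕ) := by
    rw [div_le_iff₀ two_pos]
    exact_mod_cast (by omega : h ≤ (h + 1) / 2 * 2)
  have hpow : q ^ ((h + 1) / 2) ≤ q ^ ((h : ℝ) / 2) := by
    rw [← Real.rpow_natCast]
    exact Real.rpow_le_rpow_of_exponent_ge hq0 hq1.le hfloor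
  calc ‖WithLp.toLp 2 (vecBlock (pinv H *ᵥ z) i - vecBlock (σ h i).est i)‖
      ≤ 2 * (q ^ ((h + 1) / 2) * (‖WithLp.toLp 2 z‖ / √a)) :=
        hσ.norm_vecBlock_pinv_sub_est_le (.of_spectrum_subset hH) ha hab.le i
          (Nat.mul_div_le (h + 1) 2)
    _ ≤ 2 * (q ^ ((h : ℝ) / 2) * (‖WithLp.toLp 2 z‖ / √a)) := by gcongr
    _ = 2 / (√a * q) * ‖WithLp.toLp 2 z‖ * q ^ ((h : ℝ) / 2 + 1) := by
        rw [Real.rpow_add hq0, Real.rpow_one]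
        field_simp

theorem mainTheorem4 (a b : ℝ) (hab : a < b) :
    ∃ C : ℝ, 0 < C ∧ ∃ q : ℝ, q ∈ Set.Ioo (0 : ℝ) 1 ∧
      ∀ (m : ℕ) (r n : Fin m → ℕ)
        (H : Matrix (DiffusiveEstimation.BlockIdx r) (DiffusiveEstimation.BlockIdx n) ℝ),
        H.rank = Fintype.card (DiffusiveEstimation.BlockIdx r) →
        IsLeast (spectrum ℝ (H * H.transpose)) a →
        IsGreatest (spectrum ℝ (H * H.transpose)) b →
        ∀ (z : DiffusiveEstimation.BlockIdx r → ℝ)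
          (σ : ℕ → Fin m → DiffusiveEstimation.MonitorState (DiffusiveEstimation.BlockIdx n)),
          DiffusiveEstimation.IsExecution H z σ →
          ∀ (i : Fin m) (h : ℕ),
            ‖WithLp.toLp 2
                (DiffusiveEstimation.vecBlock
                    ((DiffusiveEstimation.pinv H).mulVec z) i -
                  DiffusiveEstimation.vecBlock (σ h i).est i)‖ ≤
              C * ‖WithLp.toLp 2 z‖ * q ^ ((h : ℝ) / 2 + 1) := by
  rcases lt_or_ge 0 a with ha | ha
  · obtain ⟨C, hC, q, hq, hbound⟩ := mainTheorem4_general a b ha hab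
    exact ⟨C, hC, q, hq, fun m r n H _ hleast hgreatest =>
      hbound m r n H fun t ht => ⟨hleast.2 ht, hgreatest.2 ht⟩⟩
  · refine ⟨1, one_pos, 1 / 2, by norm_num, fun m r n H hrank hleast => ?_⟩
    exact absurd (DiffusiveEstimation.pos_of_mem_spectrum_mul_transpose hrank hleast.1) ha.not_gt
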